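/- For an injective map $f:X\to Y$ between metric spaces let $\|f\|_{\mathrm{Lip}}=\sup_{x\ne y} d_Y(f(x),f(y))/d_X(x,y)$ and $\mathrm{dist}(f)=\|f\|_{\mathrm{Lip}}\cdot\|f^{-1}\|_{\mathrm{Lip}}$, where $f^{-1}$ is defined on $f(X)$ (a supremum over the empty set being $0$). Let $\ell_\infty^n$ denote $\mathbb R^n$ with the norm $\|x\|_\infty=\max_i|x_i|$. All normed spaces and linear maps are over $\mathbb R$, and a linear embedding is an injective linear map. Proposition. For every normed space $H$, exactly one of the following two alternatives holds: 1. For every $\varepsilon>0$ and every finite-dimensional normed space $X$ there is a linear embedding $f:X\to H$ with $\mathrm{dist}(f)\le 1+\varepsilon$. 2. There exist $\beta>0$ and $c>0$ (depending only on $H$) such that for every $n\in\mathbb N$ and every linear embedding $f:\ell_\infty^n\to H$, $\mathrm{dist}(f)\ge c\,n^{\beta}$. -/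

import Mathlib

open scoped ENNReal

universe u v

noncomputable section

namespace LinearDichotomy

/-- The Lipschitz norm `sup_{x ≠ y} d(f x, f y) / d(x, y)` of a map between metric spaces, as an
extended nonnegative real (so that the supremum always exists). -/
def lipNorm {X Y : Type*} [MetricSpace X] [MetricSpace Y] (f : X → Y) : ℝ≥0∞ :=
  ⨆ (x : X) (y : X) (_ : x ≠ y), edist (f x) (f y) / edist x y

/-- The distortion `‖f‖_Lip * ‖f⁻¹‖_Lip` of an injective map between metric spaces, where
`f⁻¹ : f(X) → X` is the inverse of `f` on its range (with the metric induced from `Y`). -/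
def distortion {X Y : Type*} [MetricSpace X] [MetricSpace Y] (f : X → Y)
    (hf : Function.Injective f) : ℝ≥0∞ :=
  lipNorm f * lipNorm (Equiv.ofInjective f hf).symm

/-- The space `ℓ_∞^n`: real `n`-tuples with the sup norm `‖x‖ = max_i |x i|`. -/
abbrev EllInfty (n : ℕ) : Type := Fin n → ℝ

end LinearDichotomy

end

namespace LinearDichotomy

open Filter

/-! ### Distortion and two-sided norm estimates -/

section Distortion

variable {X Y : Type*} [NormedAddCommGroup X] [NormedSpace ℝ X]
  [NormedAddCommGroup Y] [NormedSpace ℝ Y]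

/-! Let b_n be the infimum of the b for which `HasUpperFamily H (Fin n) b` holds, so b_n ≥ 1 for n ≥
1. Blocking gives b_{mk} ≥ b_m b_k (`HasUpperFamily.of_prod`), hence either no b_n exceeds 1 or b_n
grows like a power of n. In the first case a sign-flipping trick (`HasUpperFamily.exists_linearMap`)
makes the families almost isometric copies of ℓ_∞^n, which almost contain every finite-dimensional
space. In the second, an embedding of ℓ_∞^n with distortion below K would yield an upper family with
constant K, so distortions grow too. -/

theorem lipNorm_le {X Y : Type*} [MetricSpace X] [MetricSpace Y] {f : X → Y} {K : ℝ≥0∞}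
    (h : ∀ x y, edist (f x) (f y) ≤ K * edist x y) : lipNorm f ≤ K :=
  iSup_le fun x => iSup_le fun y => iSup_le fun _ => ENNReal.div_le_of_le_mul (h x y)

theorem edist_le_lipNorm_mul {X Y : Type*} [MetricSpace X] [MetricSpace Y] (f : X → Y) {x y : X}
    (hxy : x ≠ y) : edist (f x) (f y) ≤ lipNorm f * edist x y := by
  have h : edist (f x) (f y) / edist x y ≤ lipNorm f :=
    le_iSup_of_le x (le_iSup_of_le y (le_iSup_of_le hxy le_rfl))
  rwa [ENNReal.div_le_iff (mt edist_eq_zero.1 hxy) (edist_ne_top x y)] at h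

theorem lipNorm_ne_zero {X Y : Type*} [MetricSpace X] [MetricSpace Y] [Nontrivial X] {f : X → Y}
    (hf : Function.Injective f) : lipNorm f ≠ 0 := by
  obtain ⟨x, y, hxy⟩ := exists_pair_ne X
  intro h0
  have h := edist_le_lipNorm_mul f hxy
  rw [h0, zero_mul, nonpos_iff_eq_zero, edist_eq_zero] at h
  exact hxy (hf h)

/-- A two-sided norm estimate bounds the distortion of a linear embedding. -/
theorem distortion_le_of_bounds (f : X →ₗ[ℝ] Y) (hf : Function.Injective f) {A B : ℝ}
    (hA : 0 < A) (hB : 0 ≤ B) (hlower : ∀ x, A * ‖x‖ ≤ ‖f x‖) (hupper : ∀ x, ‖f x‖ ≤ B * ‖x‖) :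
    distortion f hf ≤ ENNReal.ofReal (B / A) := by
  have h1 : lipNorm f ≤ ENNReal.ofReal B := lipNorm_le fun x y => by
    rw [edist_dist, edist_dist, ← ENNReal.ofReal_mul hB, dist_eq_norm, dist_eq_norm, ← map_sub]
    exact ENNReal.ofReal_le_ofReal (hupper _)
  have h2 : lipNorm (Equiv.ofInjective f hf).symm ≤ ENNReal.ofReal A⁻¹ := lipNorm_le fun u v => by
    obtain ⟨x, rfl⟩ := (Equiv.ofInjective f hf).surjective u
    obtain ⟨y, rfl⟩ := (Equiv.ofInjective f hf).surjective v
    rw [Equiv.symm_apply_apply, Equiv.symm_apply_apply, Subtype.edist_eq,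
      Equiv.ofInjective_apply, Equiv.ofInjective_apply, edist_dist, edist_dist,
      ← ENNReal.ofReal_mul (inv_nonneg.2 hA.le), dist_eq_norm, dist_eq_norm, ← map_sub]
    refine ENNReal.ofReal_le_ofReal ?_
    rw [inv_mul_eq_div, le_div_iff₀ hA, mul_comm]
    exact hlower _
  rw [div_eq_mul_inv, ENNReal.ofReal_mul hB]
  exact mul_le_mul' h1 h2

/-- A bound on the distortion of a linear embedding of a nontrivial space gives a two-sided norm
estimate. -/
theorem exists_bounds_of_distortion_lt [Nontrivial X] (f : X →ₗ[ℝ] Y) (hf : Function.Injective f)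
    {K : ℝ} (h : distortion f hf < ENNReal.ofReal K) :
    ∃ L M : ℝ, 0 < L ∧ 0 < M ∧ M * L < K ∧ (∀ x, ‖f x‖ ≤ L * ‖x‖) ∧
      ∀ x, ‖x‖ ≤ M * ‖f x‖ := by
  have hnt : Nontrivial (Set.range f) := (Equiv.ofInjective f hf).symm.nontrivial
  -- Neither factor vanishes, so finiteness of the product makes both finite, despite 0 · ∞ = 0.
  have hL0 : lipNorm f ≠ 0 := lipNorm_ne_zero hf
  have hM0 : lipNorm (Equiv.ofInjective f hf).symm ≠ 0 := lipNorm_ne_zero (Equiv.injective _)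
  have htop : lipNorm f * lipNorm (Equiv.ofInjective f hf).symm ≠ ∞ := h.ne_top
  have hL : lipNorm f ≠ ∞ := fun h' => htop (by rw [h', ENNReal.top_mul hM0])
  have hM : lipNorm (Equiv.ofInjective f hf).symm ≠ ∞ :=
    fun h' => htop (by rw [h', ENNReal.mul_top hL0])
  refine ⟨(lipNorm f).toReal, (lipNorm (Equiv.ofInjective f hf).symm).toReal,
    ENNReal.toReal_pos hL0 hL, ENNReal.toReal_pos hM0 hM, ?_, fun x => ?_, fun x => ?_⟩
  · rw [mul_comm, ← ENNReal.toReal_mul]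
    exact (ENNReal.lt_ofReal_iff_toReal_lt htop).1 h
  · rcases eq_or_ne x 0 with rfl | hx
    · simp
    · have h1 := ENNReal.toReal_mono (ENNReal.mul_ne_top hL (edist_ne_top _ _))
        (edist_le_lipNorm_mul f hx)
      simpa [ENNReal.toReal_mul, edist_dist, ENNReal.toReal_ofReal] using h1
  · rcases eq_or_ne x 0 with rfl | hx
    · simp
    · have h1 := ENNReal.toReal_mono (ENNReal.mul_ne_top hM (edist_ne_top _ _))
        (edist_le_lipNorm_mul (Equiv.ofInjective f hf).symm
          ((Equiv.ofInjective f hf).injective.ne hx))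
      rw [Equiv.symm_apply_apply, Equiv.symm_apply_apply, Subtype.edist_eq,
        Equiv.ofInjective_apply, Equiv.ofInjective_apply] at h1
      simpa [ENNReal.toReal_mul, edist_dist, ENNReal.toReal_ofReal] using h1

end Distortion

/-! ### Upper families and blocking -/

section UpperFamily

variable {H : Type*} [NormedAddCommGroup H] [NormedSpace ℝ H]

/-- `H` contains a family of vectors of norm at least `1`, indexed by `ι`, all of whose linear
combinations with coefficients in `[-1, 1]` have norm less than `b`. -/
def HasUpperFamily (H : Type*) [NormedAddCommGroup H] [NormedSpace ℝ H] (ι : Type*) [Fintype ι]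
    (b : ℝ) : Prop :=
  ∃ y : ι → H, (∀ i, 1 ≤ ‖y i‖) ∧ ∀ a : ι → ℝ, (∀ i, |a i| ≤ 1) → ‖∑ i, a i • y i‖ < b

theorem HasUpperFamily.of_injective {ι κ : Type*} [Fintype ι] [Fintype κ] {b : ℝ}
    (h : HasUpperFamily H κ b) {e : ι → κ} (he : Function.Injective e) :
    HasUpperFamily H ι b := by
  classical
  obtain ⟨y, hy, hb⟩ := h
  refine ⟨y ∘ e, fun i => hy _, fun a ha => ?_⟩
  have h1 : ∑ i, a i • (y ∘ e) i = ∑ k, Function.extend e a 0 k • y k := by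
    rw [← Finset.sum_subset (Finset.subset_univ (Finset.univ.image e)),
      Finset.sum_image he.injOn]
    · simp [he.extend_apply]
    · intro k _ hk
      rw [Function.extend_apply' _ _ _ (by simpa using hk)]
      simp
  rw [h1]
  refine hb _ fun k => ?_
  by_cases hk : ∃ i, e i = k
  · obtain ⟨i, rfl⟩ := hk
    rw [he.extend_apply]
    exact ha i
  · rw [Function.extend_apply' _ _ _ hk]
    simp

/-- Each row, failing to have constant c, has a combination of norm at least c; these row sums,
divided by c, form the new family. -/
theorem HasUpperFamily.of_prod {ι κ : Type*} [Fintype ι] [Fintype κ] {b c : ℝ} (hc : 0 < c)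
    (h : HasUpperFamily H (ι × κ) (b * c)) (hκ : ¬ HasUpperFamily H κ c) :
    HasUpperFamily H ι b := by
  obtain ⟨y, hy, hb⟩ := h
  have hex : ∀ i, ∃ a : κ → ℝ, (∀ j, |a j| ≤ 1) ∧ c ≤ ‖∑ j, a j • y (i, j)‖ := by
    intro i
    by_contra! hcon
    exact hκ ⟨fun j => y (i, j), fun j => hy _, hcon⟩
  choose a ha hac using hex
  refine ⟨fun i => c⁻¹ • ∑ j, a i j • y (i, j), fun i => ?_, fun t ht => ?_⟩
  · rw [norm_smul, Real.norm_of_nonneg (inv_nonneg.2 hc.le), inv_mul_eq_div, le_div_iff₀ hc,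
      one_mul]
    exact hac i
  · have h1 : ∑ i, t i • c⁻¹ • ∑ j, a i j • y (i, j) =
        c⁻¹ • ∑ p : ι × κ, (t p.1 * a p.1 p.2) • y p := by
      rw [Fintype.sum_prod_type, Finset.smul_sum]
      refine Finset.sum_congr rfl fun i _ => ?_
      rw [smul_comm, Finset.smul_sum]
      simp_rw [smul_smul]
    rw [h1, norm_smul, Real.norm_of_nonneg (inv_nonneg.2 hc.le), inv_mul_eq_div, div_lt_iff₀ hc]
    refine hb _ fun p => ?_
    rw [abs_mul]
    exact mul_le_one₀ (ht _) (abs_nonneg _) (ha _ _)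

theorem not_hasUpperFamily_pow {m : ℕ} {b : ℝ} (hb : 0 < b)
    (h : ¬ HasUpperFamily H (Fin m) b) (k : ℕ) :
    ¬ HasUpperFamily H (Fin (m ^ k)) (b ^ k) := by
  induction k with
  | zero =>
    rintro ⟨y, hy, hlt⟩
    have h1 := hlt (fun _ => 1) (by simp)
    simp only [one_smul, pow_zero] at h1
    have h2 : ∑ i, y i = y ⟨0, by simp⟩ :=
      Fintype.sum_eq_single _ fun i hi => absurd (Fin.ext (by have := i.2; simp at this ⊢; omega)) hi
    rw [h2] at h1
    exact absurd (hy _) (not_le.2 h1)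
  | succ k ih =>
    intro hk
    have e : Fin m × Fin (m ^ k) ≃ Fin (m ^ (k + 1)) :=
      finProdFinEquiv.trans (finCongr (pow_succ' m k).symm)
    rw [pow_succ' b] at hk
    exact h ((hk.of_injective e.injective).of_prod (pow_pos hb k) ih)

theorem hasUpperFamily_of_distortion_lt {n : ℕ} (hn : n ≠ 0) (f : EllInfty n →ₗ[ℝ] H)
    (hf : Function.Injective f) {K : ℝ} (h : distortion f hf < ENNReal.ofReal K) :
    HasUpperFamily H (Fin n) K := by
  have : NeZero n := ⟨hn⟩
  obtain ⟨L, M, hL, hM, hML, hupper, hlower⟩ := exists_bounds_of_distortion_lt f hf h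
  -- Scaling by M lifts the images of unit vectors to norm at least 1; the upper constant becomes M
  -- * L < K.
  refine ⟨fun i => M • f (Pi.single i 1), fun i => ?_, fun a ha => ?_⟩
  · have h1 := hlower (Pi.single i 1)
    rw [norm_smul, Real.norm_of_nonneg hM.le]
    simpa [Pi.norm_single] using h1
  · have h1 : ∑ i, a i • M • f (Pi.single i 1) = M • f a := by
      conv_rhs => rw [pi_eq_sum_univ' a, map_sum, Finset.smul_sum]
      refine Finset.sum_congr rfl fun i _ => ?_
      rw [map_smul, smul_comm]
    have ha1 : ‖a‖ ≤ 1 := (pi_norm_le_iff_of_nonneg zero_le_one).2 ha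
    rw [h1, norm_smul, Real.norm_of_nonneg hM.le]
    calc M * ‖f a‖ ≤ M * (L * 1) := by
          gcongr
          exact (hupper a).trans (by gcongr)
      _ < K := by rwa [mul_one]

/-- An upper estimate for a family of vectors of norm at least `1` implies a lower one. -/
theorem HasUpperFamily.exists_linearMap {ι : Type*} [Fintype ι] {η : ℝ} (hη : 0 < η)
    (h : HasUpperFamily H ι (1 + η)) :
    ∃ T : (ι → ℝ) →ₗ[ℝ] H, ∀ a, (1 - η) * ‖a‖ ≤ ‖T a‖ ∧ ‖T a‖ ≤ (1 + η) * ‖a‖ := by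
  classical
  obtain ⟨y, hy, hb⟩ := h
  have hT : ∀ a, Fintype.linearCombination ℝ y a = ∑ i, a i • y i :=
    Fintype.linearCombination_apply ℝ y
  have hupper : ∀ a : ι → ℝ, ‖Fintype.linearCombination ℝ y a‖ ≤ (1 + η) * ‖a‖ := by
    intro a
    rcases eq_or_ne a 0 with rfl | ha
    · simp
    have hpos : 0 < ‖a‖ := norm_pos_iff.2 ha
    have h1 := hb (‖a‖⁻¹ • a) fun i => by
      rw [Pi.smul_apply, smul_eq_mul, abs_mul, abs_inv, abs_norm, inv_mul_eq_div,
        div_le_one hpos]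
      exact norm_le_pi_norm a i
    rw [← hT, map_smul, norm_smul, norm_inv, norm_norm, inv_mul_eq_div, div_lt_iff₀ hpos] at h1
    exact h1.le
  refine ⟨Fintype.linearCombination ℝ y, fun a => ⟨?_, hupper a⟩⟩
  rcases isEmpty_or_nonempty ι with hι | hι
  · simp [Subsingleton.elim a 0]
  obtain ⟨i, hi⟩ : ∃ i, ‖a i‖ = ‖a‖ := by
    obtain ⟨i, -, hi⟩ := Finset.exists_max_image Finset.univ (fun i => ‖a i‖)
      Finset.univ_nonempty
    exact ⟨i, le_antisymm (norm_le_pi_norm a i)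
      ((pi_norm_le_iff_of_nonneg (norm_nonneg _)).2 fun j => hi j (Finset.mem_univ j))⟩
  -- Flip every sign of a except at a maximal coordinate i: the sup norm is unchanged and a + a' is
  -- supported at i, so 2‖a‖ ≤ ‖T a‖ + ‖T a'‖.
  set a' : ι → ℝ := Pi.single i (2 * a i) - a with ha'
  have hsum : (2 * a i) • y i =
      Fintype.linearCombination ℝ y a + Fintype.linearCombination ℝ y a' := by
    rw [← map_add, ha', add_sub_cancel, Fintype.linearCombination_apply_single]
  have hnorm : ‖a'‖ ≤ ‖a‖ := by
    refine (pi_norm_le_iff_of_nonneg (norm_nonneg _)).2 fun j => ?_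
    rcases eq_or_ne j i with rfl | hj
    · simp only [ha', Pi.sub_apply, Pi.single_eq_same]
      rw [← hi]
      apply le_of_eq
      congr 1
      ring
    · simpa [ha', hj] using norm_le_pi_norm a j
  have h1 : 2 * ‖a‖ ≤ ‖(2 * a i) • y i‖ := by
    rw [norm_smul, norm_mul, hi, Real.norm_two]
    exact le_mul_of_one_le_right (by positivity) (hy i)
  have h2 := norm_add_le (Fintype.linearCombination ℝ y a) (Fintype.linearCombination ℝ y a')
  have h3 : ‖Fintype.linearCombination ℝ y a'‖ ≤ (1 + η) * ‖a‖ :=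
    (hupper a').trans (by gcongr)
  rw [← hsum] at h2
  linarith

end UpperFamily

/-- Every finite-dimensional normed space embeds almost isometrically in some `ℓ_∞^n`. -/
theorem exists_linearMap_ellInfty (X : Type*) [NormedAddCommGroup X] [NormedSpace ℝ X]
    [FiniteDimensional ℝ X] {η : ℝ} (hη : 0 < η) :
    ∃ (n : ℕ) (T : X →ₗ[ℝ] EllInfty n), ∀ x, (1 - η) * ‖x‖ ≤ ‖T x‖ ∧ ‖T x‖ ≤ ‖x‖ := by
  have : ProperSpace X := FiniteDimensional.proper ℝ X
  obtain ⟨t, ht, htfin, hcover⟩ :=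
    (isCompact_sphere (0 : X) 1).finite_cover_balls hη
  have : Fintype t := htfin.fintype
  have hφ : ∀ x : X, ∃ g : StrongDual ℝ X, ‖g‖ ≤ 1 ∧ g x = ‖x‖ := exists_dual_vector'' ℝ
  -- The coordinates are norming functionals of the points of an η-net of the sphere.
  choose φ hφ1 hφ2 using hφ
  let e := Fintype.equivFin t
  refine ⟨Fintype.card t, LinearMap.pi fun i => (φ (e.symm i)).toLinearMap, fun x => ⟨?_, ?_⟩⟩
  · rcases eq_or_ne x 0 with rfl | hx
    · simp
    have hpos : 0 < ‖x‖ := norm_pos_iff.2 hx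
    have hmem : ‖x‖⁻¹ • x ∈ Metric.sphere (0 : X) 1 := by
      simp [norm_smul, hpos.ne']
    obtain ⟨z, hz, hzx⟩ := Set.mem_iUnion₂.1 (hcover hmem)
    have hz1 : ‖z‖ = 1 := by simpa using ht hz
    rw [Metric.mem_ball, dist_eq_norm] at hzx
    have h1 : φ z (‖x‖⁻¹ • x - z) ≥ -η := by
      have h := ((φ z).le_of_opNorm_le (hφ1 z) (‖x‖⁻¹ • x - z))
      rw [one_mul] at h
      exact (abs_le.1 (h.trans hzx.le)).1
    rw [map_sub, hφ2, hz1, map_smul, smul_eq_mul, inv_mul_eq_div] at h1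
    have h2 : 1 - η ≤ φ z x / ‖x‖ := by
      norm_num at h1
      linarith
    rw [le_div_iff₀ hpos] at h2
    refine h2.trans ((le_abs_self _).trans ?_)
    have h3 := norm_le_pi_norm (LinearMap.pi (fun i => (φ (e.symm i)).toLinearMap) x) (e ⟨z, hz⟩)
    simpa using h3
  · refine (pi_norm_le_iff_of_nonneg (norm_nonneg _)).2 fun i => ?_
    simpa using (φ (e.symm i)).le_of_opNorm_le (hφ1 _) x

/-- If `H` has almost optimal upper families of every finite size, then every finite-dimensional
space embeds almost isometrically in `H`. -/
theorem exists_embedding_of_hasUpperFamily {H : Type*} [NormedAddCommGroup H] [NormedSpace ℝ H]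
    (h : ∀ (n : ℕ) (b : ℝ), 1 < b → HasUpperFamily H (Fin n) b) {ε : ℝ} (hε : 0 < ε)
    (X : Type*) [NormedAddCommGroup X] [NormedSpace ℝ X] [FiniteDimensional ℝ X] :
    ∃ (f : X →ₗ[ℝ] H) (hf : Function.Injective f),
      distortion f hf ≤ ENNReal.ofReal (1 + ε) := by
  -- This η solves (1 + ε)(1 - 2η) = 1 + η, whence (1 + η) / (1 - η)² ≤ 1 + ε.
  obtain ⟨η, hη0, hη1, hηε⟩ : ∃ η : ℝ, 0 < η ∧ η < 1 ∧ 3 * η + 2 * ε * η = ε :=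
    ⟨ε / (3 + 2 * ε), by positivity, by rw [div_lt_one (by positivity)]; linarith,
      by field_simp⟩
  obtain ⟨n, S, hS⟩ := exists_linearMap_ellInfty X hη0
  obtain ⟨T, hT⟩ := (h n (1 + η) (by linarith)).exists_linearMap hη0
  have hη : 0 < 1 - η := by linarith
  have hlower : ∀ x, (1 - η) ^ 2 * ‖x‖ ≤ ‖(T ∘ₗ S) x‖ := fun x => by
    rw [pow_two, mul_assoc]
    exact (mul_le_mul_of_nonneg_left (hS x).1 hη.le).trans (hT (S x)).1
  have hupper : ∀ x, ‖(T ∘ₗ S) x‖ ≤ (1 + η) * ‖x‖ := fun x =>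
    (hT (S x)).2.trans (mul_le_mul_of_nonneg_left (hS x).2 (by linarith))
  have hinj : Function.Injective (T ∘ₗ S) := by
    refine (injective_iff_map_eq_zero _).2 fun x hx => ?_
    have h1 := hlower x
    rw [hx, norm_zero] at h1
    exact norm_le_zero_iff.1 (nonpos_of_mul_nonpos_right h1 (by positivity))
  refine ⟨T ∘ₗ S, hinj, (distortion_le_of_bounds _ hinj (pow_pos hη 2) (by linarith)
    hlower hupper).trans (ENNReal.ofReal_le_ofReal ?_)⟩
  rw [div_le_iff₀ (by positivity)]
  nlinarith [mul_nonneg (by linarith : (0 : ℝ) ≤ 1 + ε) (sq_nonneg η)]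

/-- If `H` lacks an upper family of some size and constant larger than `1`, then the distortion of
`ℓ_∞^n` in `H` grows at least like a power of `n`. -/
theorem exists_power_lower_bound {H : Type*} [NormedAddCommGroup H] [NormedSpace ℝ H] {m : ℕ}
    {b : ℝ} (hb : 1 < b) (h : ¬ HasUpperFamily H (Fin m) b) :
    ∃ β : ℝ, 0 < β ∧ ∃ c : ℝ, 0 < c ∧ ∀ (n : ℕ) (f : EllInfty n →ₗ[ℝ] H)
      (hf : Function.Injective f), ENNReal.ofReal (c * (n : ℝ) ^ β) ≤ distortion f hf := by
  wlog hm : 2 ≤ m generalizing m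
  · exact this (m := max m 2)
      (fun h' => h (h'.of_injective (Fin.castLE_injective (le_max_left m 2)))) (le_max_right m 2)
  have hb0 : 0 < b := one_pos.trans hb
  have hm1 : (1 : ℝ) < m := by exact_mod_cast hm
  have hβ : 0 < Real.logb m b := Real.logb_pos hm1 hb
  -- The exponent satisfies m ^ β = b; the factor b⁻¹ pays for rounding n down to a power of m.
  refine ⟨Real.logb m b, hβ, b⁻¹, inv_pos.2 hb0, fun n f hf => ?_⟩
  rcases eq_or_ne n 0 with rfl | hn
  · simp [Real.zero_rpow hβ.ne']
  set k := Nat.log m n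
  have hkn : m ^ k ≤ n := Nat.pow_log_le_self m hn
  have hnk : n < m ^ (k + 1) := Nat.lt_pow_succ_log_self hm n
  by_contra! hlt
  have hle : b⁻¹ * (n : ℝ) ^ Real.logb m b ≤ b ^ k := by
    have h1 : (n : ℝ) ≤ (m : ℝ) ^ (k + 1) := by exact_mod_cast hnk.le
    have h2 : (n : ℝ) ^ Real.logb m b ≤ b ^ (k + 1) := by
      refine (Real.rpow_le_rpow n.cast_nonneg h1 hβ.le).trans_eq ?_
      rw [← Real.rpow_natCast, ← Real.rpow_mul (by positivity), mul_comm,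
        Real.rpow_mul (by positivity), Real.rpow_logb (by positivity) hm1.ne' hb0,
        Real.rpow_natCast]
    rw [inv_mul_eq_div, div_le_iff₀ hb0, ← pow_succ]
    exact h2
  exact not_hasUpperFamily_pow hb0 h k
    ((hasUpperFamily_of_distortion_lt hn f hf
      (hlt.trans_le (ENNReal.ofReal_le_ofReal hle))).of_injective (Fin.castLE_injective hkn))

/-- Almost isometric copies of all finite-dimensional spaces contradict a power lower bound. -/
theorem not_power_lower_bound_of_embeddings {H : Type u} [NormedAddCommGroup H] [NormedSpace ℝ H]
    (h : ∀ ε : ℝ, 0 < ε →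
      ∀ (X : Type v) [NormedAddCommGroup X] [NormedSpace ℝ X] [FiniteDimensional ℝ X],
        ∃ (f : X →ₗ[ℝ] H) (hf : Function.Injective f),
          distortion f hf ≤ ENNReal.ofReal (1 + ε)) {β c : ℝ} (hβ : 0 < β) (hc : 0 < c) :
    ∃ (n : ℕ) (f : EllInfty n →ₗ[ℝ] H) (hf : Function.Injective f),
      distortion f hf < ENNReal.ofReal (c * (n : ℝ) ^ β) := by
  have htend : Tendsto (fun n : ℕ => c * (n : ℝ) ^ β) atTop atTop :=
    ((tendsto_rpow_atTop hβ).comp tendsto_natCast_atTop_atTop).const_mul_atTop hc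
  obtain ⟨n, hn3, hn1⟩ :=
    ((htend.eventually_gt_atTop 3).and (eventually_ge_atTop 1)).exists
  have : NeZero n := ⟨by omega⟩
  -- `ULift` moves ℓ_∞^n isometrically to universe `v`; ε = 1 gives distortion at most 2 < 3.
  obtain ⟨g, hg, hgd⟩ := h 1 one_pos (ULift.{v} (Fin n → ℝ))
  obtain ⟨L, M, hL, hM, hML, hupper, hlower⟩ := exists_bounds_of_distortion_lt (K := 3) g hg
    (hgd.trans_lt ((ENNReal.ofReal_lt_ofReal_iff (by norm_num)).2 (by norm_num)))
  let f : EllInfty n →ₗ[ℝ] H := g ∘ₗ (ULift.moduleEquiv (R := ℝ)).symm.toLinearMap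
  have hf : Function.Injective f := hg.comp (LinearEquiv.injective _)
  refine ⟨n, f, hf, (distortion_le_of_bounds f hf (inv_pos.2 hM) hL.le (fun x => ?_)
    fun x => hupper (ULift.up x)).trans_lt ((ENNReal.ofReal_lt_ofReal_iff (by linarith)).2 ?_)⟩
  · rw [inv_mul_eq_div, div_le_iff₀ hM, mul_comm]
    exact hlower (ULift.up x)
  · rw [div_inv_eq_mul, mul_comm]
    linarith

end LinearDichotomy

theorem mainTheorem3 (H : Type u) [NormedAddCommGroup H] [NormedSpace ℝ H] :
    Xor
      (∀ ε : ℝ, 0 < ε →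
        ∀ (X : Type v) [NormedAddCommGroup X] [NormedSpace ℝ X] [FiniteDimensional ℝ X],
          ∃ (f : X →ₗ[ℝ] H) (hf : Function.Injective f),
            LinearDichotomy.distortion f hf ≤ ENNReal.ofReal (1 + ε))
      (∃ β : ℝ, 0 < β ∧ ∃ c : ℝ, 0 < c ∧
        ∀ (n : ℕ) (f : LinearDichotomy.EllInfty n →ₗ[ℝ] H) (hf : Function.Injective f),
          ENNReal.ofReal (c * (n : ℝ) ^ β) ≤ LinearDichotomy.distortion f hf) := by
  by_cases h : ∀ (n : ℕ) (b : ℝ), 1 < b → LinearDichotomy.HasUpperFamily H (Fin n) b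
  · have h1 := fun (ε : ℝ) (hε : 0 < ε) (X : Type v) [NormedAddCommGroup X] [NormedSpace ℝ X]
      [FiniteDimensional ℝ X] => LinearDichotomy.exists_embedding_of_hasUpperFamily h hε X
    refine Or.inl ⟨h1, ?_⟩
    rintro ⟨β, hβ, c, hc, h2⟩
    obtain ⟨n, f, hf, hlt⟩ :=
      LinearDichotomy.not_power_lower_bound_of_embeddings h1 hβ hc
    exact hlt.not_ge (h2 n f hf)
  · push Not at h
    obtain ⟨n, b, hb, hnot⟩ := h
    obtain ⟨β, hβ, c, hc, h2⟩ := LinearDichotomy.exists_power_lower_bound hb hnot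
    refine Or.inr ⟨⟨β, hβ, c, hc, h2⟩, fun h1 => ?_⟩
    obtain ⟨n, f, hf, hlt⟩ :=
      LinearDichotomy.not_power_lower_bound_of_embeddings h1 hβ hc
    exact hlt.not_ge (h2 n f hf)
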